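/- **Proposition (Bayesian Counterfactual Mean Embedding).** Let $k_x$ be a real symmetric positive semidefinite kernel on a set $\mathcal X$ and $k_y$ one on a measurable space $\mathcal Y$. Let $\nu$ be a finite measure on $\mathcal Y$ with $k_y(y,\cdot)\in L^2(\nu)$ for every $y\in\mathcal Y$, and let $$r(y_1,y_2)=\int k_y(y_1,u)\,k_y(u,y_2)\,\nu(du)$$ be the self-convolution of $k_y$. Let $\lambda>0$ and $m\ge 1$, and let $\mathbf x=(x_i)_{i\le n}$, $\mathbf y=(y_i)_{i\le n}$ and $\mathbf x'=(x'_j)_{j\le m}$ be realized values of samples $\{(x_i,y_i)\}_{i=1}^n$ from $\mathbb P_{XY}$ and $x'_1,\dots,x'_m$ from $\mathbb P_{X'}$. The statement is conditional on these values: it holds for all of them for which the matrix $R_{\mathbf y\mathbf y}=(r(y_i,y_j))_{i,j}$ is invertible. Model the conditional mean embedding $(x,y)\mapsto\mu_{Y|X=x}(y)$ by a Gaussian process $\mu_{gp}$ on $\mathcal X\times\mathcal Y$ with prior $\mu_{gp}\sim GP(0,k_x\otimes r)$, that is, with covariance $k_x(x,\tilde x)\,r(y,\tilde y)$, and consider the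 function-valued regression $$\phi_y(y_i)=\mu_{gp}(x_i,\cdot)+\lambda^{1/2}\varepsilon_i,\qquad i=1,\dots,n,$$ where $\phi_y(y_i)=k_y(\cdot,y_i)$ and $\varepsilon_1,\dots,\varepsilon_n$ are i.i.d. $GP(0,r)$, independent of $\mu_{gp}$. The responses are observed at the points $y_1,\dots,y_n$: the random matrix $Z_{ij}=\mu_{gp}(x_i,y_j)+\lambda^{1/2}\varepsilon_i(y_j)$ is observed to take the value $K_{\mathbf y\mathbf y}=(k_y(y_i,y_j))_{i,j}$. The counterfactual mean embedding is the average over the second sample, $$\mu_{Y\langle 0|1\rangle}(y)=\frac1m\sum_{j=1}^m\mu_{gp}(x'_j,y).$$ The posterior law of $\mu_{Y\langle 0|1\rangle}$ given $Z=K_{\mathbf y\mathbf y}$ is the value at $K_{\mathbf y\mathbf y}$ of a regular conditional distribution of the process $(\mu_{Y\langle 0|1\rangle}(y))_{y\in\mathcal Y}$ given $Z$ whose finite-dimensional distributions depend weakly continuously on the observed value. Then this posterior law exists and is unique, and it is the law of a Gaussian process on $\mathcal Y$ with mean and covariance $$m(y)=\frac1m\mathbf 1_m^\top K_{\mathbf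 x'\mathbf x}(K_{\mathbf x\mathbf x}+\lambda I)^{-1}K_{\mathbf y\mathbf y}R_{\mathbf y\mathbf y}^{-1}r_{\mathbf y y},$$ $$\kappa(y,y')=\frac1{m^2}\mathbf 1_m^\top\Big(K_{\mathbf x'\mathbf x'}\,r(y,y')-K_{\mathbf x'\mathbf x}(K_{\mathbf x\mathbf x}+\lambda I)^{-1}K_{\mathbf x\mathbf x'}\;r_{y\mathbf y}R_{\mathbf y\mathbf y}^{-1}r_{\mathbf y y'}\Big)\mathbf 1_m.$$ Here $K_{\mathbf a\mathbf b}=(k_x(a_i,b_j))_{i,j}$ for tuples $\mathbf a,\mathbf b$ in $\mathcal X$, $r_{\mathbf y y}=(r(y_i,y))_i$ is a column vector, $r_{y\mathbf y}=r_{\mathbf y y}^\top$, and $\mathbf 1_m=(1,\dots,1)^\top\in\mathbb R^m$. -/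

import Mathlib

open MeasureTheory ProbabilityTheory
open scoped Matrix

namespace BayesCFME

/-- A (real) reproducing kernel on an arbitrary set: a symmetric positive semidefinite function.
`Matrix.PosSemidef` on an arbitrary index type means symmetry together with nonnegativity of all
finite quadratic forms. -/
def IsKernel {S : Type*} (k : S → S → ℝ) : Prop :=
  (Matrix.of k).PosSemidef

/-- The self-convolution `r (y₁, y₂) = ∫ k (y₁, u) k (u, y₂) ν(du)` of a kernel `k`. -/
noncomputable def selfConv {S : Type*} [MeasurableSpace S] (ν : Measure S) (k : S → S → ℝ)
    (y₁ y₂ : S) : ℝ :=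
  ∫ u, k y₁ u * k u y₂ ∂ν

/-- The tensor product kernel `(k ⊗ r) ((x, y), (x', y')) = k (x, x') r (y, y')`. -/
def tensorKernel {S T : Type*} (k : S → S → ℝ) (r : T → T → ℝ) (p q : S × T) : ℝ :=
  k p.1 q.1 * r p.2 q.2

/-- The matrix `K_{ab}` with entries `k (a_i, b_j)`. -/
def gram {S : Type*} {p q : ℕ} (k : S → S → ℝ) (a : Fin p → S) (b : Fin q → S) :
    Matrix (Fin p) (Fin q) ℝ :=
  Matrix.of fun i j => k (a i) (b j)

/-- `X ~ GP(m, K)` under `P`: a family of random variables with Gaussian finite-dimensional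
distributions, mean function `m` and covariance function `K`. -/
structure IsGP {Ω T : Type*} [MeasurableSpace Ω] (X : T → Ω → ℝ) (m : T → ℝ) (K : T → T → ℝ)
    (P : Measure Ω) : Prop where
  measurable : ∀ t, Measurable (X t)
  gaussian : IsGaussianProcess X P
  mean : ∀ t, P[X t] = m t
  cov : ∀ s t, cov[X s, X t; P] = K s t

/-- The law `Q` on the path space `T → ℝ` is that of a `GP(m, K)`. -/
def IsGPLaw {T : Type*} (Q : Measure (T → ℝ)) (m : T → ℝ) (K : T → T → ℝ) : Prop :=
  IsGP (fun (t : T) (f : T → ℝ) => f t) m K Q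

/-- The Bayesian conditional mean embedding model: the conditional mean embedding
`(x, y) ↦ μ_{Y|X=x}(y)` has prior `GP(0, k ⊗ r)`, and the noise functions `ε_1, …, ε_n` are
i.i.d. `GP(0, r)`, independent of it. -/
structure IsBayesCMEModel {Ω S T : Type*} [MeasurableSpace Ω] {n : ℕ}
    (kx : S → S → ℝ) (r : T → T → ℝ) (μ : S × T → Ω → ℝ) (ε : Fin n → T → Ω → ℝ)
    (P : Measure Ω) : Prop where
  prior : IsGP μ 0 (tensorKernel kx r) P
  noise : ∀ i, IsGP (ε i) 0 r P
  noise_indep : iIndepFun (fun i ω t => ε i t ω) P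
  prior_indep_noise : IndepFun (fun ω p => μ p ω) (fun ω i t => ε i t ω) P

/-- The response functions `μ(x_i, ·) + λ^{1/2} ε_i` of the function-valued regression, evaluated
at the sample points: entry `(i, j)` is the value of the `i`-th response function at `y_j`. -/
noncomputable def response {Ω S T : Type*} {n : ℕ} (lam : ℝ) (x : Fin n → S) (y : Fin n → T)
    (μ : S × T → Ω → ℝ) (ε : Fin n → T → Ω → ℝ) (ω : Ω) : Fin n → Fin n → ℝ :=
  fun i j => μ (x i, y j) ω + √lam * ε i (y j) ω

/-- The observed responses: the `i`-th response function is the feature `φ_y(y_i) = k_y(·, y_i)`,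
evaluated at `y_j`. -/
def observed {T : Type*} {n : ℕ} (ky : T → T → ℝ) (y : Fin n → T) : Fin n → Fin n → ℝ :=
  fun i j => ky (y j) (y i)

/-- The counterfactual mean embedding over the sample `x'_1, …, x'_m`: the average
`y ↦ (1/m) ∑_j μ_{Y|X=x'_j}(y)` of the conditional mean embeddings. -/
noncomputable def cfme {Ω S T : Type*} {m : ℕ} (x' : Fin m → S) (μ : S × T → Ω → ℝ)
    (t : T) (ω : Ω) : ℝ :=
  (1 / (m : ℝ)) * ∑ j, μ (x' j, t) ω

/-- `Q` is the posterior law of the process `F` given the observation `Z = z₀`: it is the value at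
`z₀` of a regular conditional distribution of `F` given `Z` whose finite-dimensional
distributions depend weakly continuously on the observed value. (Continuity gives a meaning to
conditioning on a single value, although that value has probability zero.) -/
def IsPosteriorLaw {Ω D T : Type*} [MeasurableSpace Ω] [MeasurableSpace D] [TopologicalSpace D]
    (P : Measure Ω) (F : T → Ω → ℝ) (Z : Ω → D) (z₀ : D) (Q : Measure (T → ℝ)) : Prop :=
  ∃ κ : Kernel D (T → ℝ), IsMarkovKernel κ ∧
    HasCondDistrib (fun ω t => F t ω) Z κ P ∧
    (∀ (I : Finset T) (g : BoundedContinuousFunction (I → ℝ) ℝ),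
      Continuous fun z => ∫ f, g (I.restrict f) ∂(κ z)) ∧
    κ z₀ = Q

/-- `(1/m) 1ᵀ K_{x'x} (K_{xx} + λ I)⁻¹ K_{yy} R_{yy}⁻¹ r_{y t}`. -/
noncomputable def postMean {S T : Type*} {n m : ℕ} (kx : S → S → ℝ) (ky r : T → T → ℝ) (lam : ℝ)
    (x : Fin n → S) (y : Fin n → T) (x' : Fin m → S) (t : T) : ℝ :=
  (1 / (m : ℝ)) *
    ((1 : Fin m → ℝ) ⬝ᵥ
      ((gram kx x' x * (gram kx x x + lam • (1 : Matrix (Fin n) (Fin n) ℝ))⁻¹ *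
        gram ky y y * (gram r y y)⁻¹) *ᵥ fun j => r (y j) t))

/-- `(1/m²) 1ᵀ (K_{x'x'} r_{t,t'} - K_{x'x} (K_{xx} + λ I)⁻¹ K_{xx'} r_{t y} R_{yy}⁻¹ r_{y t'}) 1`.
-/
noncomputable def postCov {S T : Type*} {n m : ℕ} (kx : S → S → ℝ) (r : T → T → ℝ) (lam : ℝ)
    (x : Fin n → S) (y : Fin n → T) (x' : Fin m → S) (t t' : T) : ℝ :=
  (1 / (m : ℝ) ^ 2) *
    ((1 : Fin m → ℝ) ⬝ᵥ
      ((r t t' • gram kx x' x' -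
        ((fun j => r t (y j)) ⬝ᵥ ((gram r y y)⁻¹ *ᵥ fun j => r (y j) t')) •
          (gram kx x' x * (gram kx x x + lam • (1 : Matrix (Fin n) (Fin n) ℝ))⁻¹ *
            gram kx x x')) *ᵥ (1 : Fin m → ℝ)))

end BayesCFME

open MeasureTheory ProbabilityTheory
open scoped Matrix MatrixOrder

namespace BayesCFME

/-! The noise has the covariance `r` of the prior's second factor, so the covariance of the observed
matrix `Z` is the Kronecker product of `K_xx + λI` and `R_yy`. The first factor is positive definite
since `λ > 0`, the second since it is positive semidefinite and invertible.

Existence: `F`, the counterfactual embedding, and `Z` are linear in one Gaussian process. Write `F =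
A(Z) + G` with `A` the linear regression on `Z`. The residual `G` is uncorrelated with `Z`, hence
independent of it, so the law of `A(z₀) + G` is a version of the conditional law that is weakly
continuous in `z₀` (`exists_isPosteriorLaw_isGPLaw`). The Kronecker structure gives the regression
weights in product form, which yields the stated formulas.

Uniqueness: two versions agree for almost every observed value. The law of `Z` charges every
nonempty open set, so continuity makes them agree everywhere (`IsPosteriorLaw.unique`). -/

/-! ### Uniqueness and existence of posterior laws. -/

/-- A Gaussian vector with positive definite covariance matrix charges every nonempty open set. -/
lemma isOpenPosMeasure_map_of_posDef {Ω ι : Type*} [MeasurableSpace Ω] [Fintype ι]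
    [DecidableEq ι] {P : Measure Ω} {Z : ι → Ω → ℝ}
    (hZ : HasGaussianLaw (fun ω i => Z i ω) P) {S : Matrix ι ι ℝ} (hS : S.PosDef)
    (hcov : ∀ i j, cov[Z i, Z j; P] = S i j) :
    (P.map fun ω i => Z i ω).IsOpenPosMeasure := by
  have hP : IsProbabilityMeasure P := hZ.isProbabilityMeasure
  have hZ' : HasGaussianLaw (fun ω => WithLp.toLp 2 fun i => Z i ω) P := hZ.toLp_pi 2
  have hmap : P.map (fun ω => WithLp.toLp 2 fun i => Z i ω) =
      multivariateGaussian (P[fun ω => WithLp.toLp 2 fun i => Z i ω]) S := by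
    have := hZ'.isGaussian_map
    apply IsGaussian.ext
    · rw [integral_id_multivariateGaussian', integral_map hZ'.aemeasurable (by fun_prop)]
      rfl
    · ext u v
      rw [covarianceBilin_multivariateGaussian hS.posSemidef,
        covarianceBilin_apply_pi fun i => (hZ.eval i).memLp_two]
      simp [hcov, dotProduct, Matrix.mulVec, Finset.mul_sum]
      refine Finset.sum_congr rfl fun i _ => Finset.sum_congr rfl fun j _ => ?_
      ring
  have h0 : (gaussianReal 0 1).IsOpenPosMeasure :=
    (gaussianReal_absolutelyContinuous' 0 one_ne_zero).isOpenPosMeasure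
  have h1 : (stdGaussian (EuclideanSpace ℝ ι)).IsOpenPosMeasure := by
    rw [← map_pi_eq_stdGaussian]
    exact (PiLp.continuous_toLp 2 _).isOpenPosMeasure_map (WithLp.toLp_surjective 2)
  -- The Gaussian law with covariance `S` is the image of the standard one under an affine map with
  -- linear part `√S`. This map is onto because `√S * √S = S` is invertible.
  have hsqrt : Function.Surjective (Matrix.toEuclideanCLM (n := ι) (𝕜 := ℝ) (CFC.sqrt S)) := by
    have hu : IsUnit (CFC.sqrt S) := by
      have := hS.isUnit
      rw [← CFC.sqrt_mul_sqrt_self S hS.posSemidef.nonneg] at this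
      exact isUnit_of_mul_isUnit_left this
    obtain ⟨B, hB⟩ := hu.exists_right_inv
    intro v
    refine ⟨Matrix.toEuclideanCLM (n := ι) (𝕜 := ℝ) B v, ?_⟩
    rw [← _root_.mul_apply_eq_comp, ← map_mul, hB, map_one]
    rfl
  have h2 : (multivariateGaussian (P[fun ω => WithLp.toLp 2 fun i => Z i ω])
      S).IsOpenPosMeasure :=
    Continuous.isOpenPosMeasure_map (by fun_prop)
      ((Equiv.addLeft _).surjective.comp hsqrt)
  have h3 : P.map (fun ω i => Z i ω) =
      (multivariateGaussian (P[fun ω => WithLp.toLp 2 fun i => Z i ω]) S).map WithLp.ofLp := by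
    rw [← hmap, AEMeasurable.map_map_of_aemeasurable (by fun_prop) hZ'.aemeasurable]
    rfl
  rw [h3]
  exact (PiLp.continuous_ofLp 2 _).isOpenPosMeasure_map (WithLp.ofLp_surjective 2)

/-- Posterior laws are unique if the law of the observation charges every nonempty open set. -/
lemma IsPosteriorLaw.unique {Ω D T : Type*} [MeasurableSpace Ω] [MeasurableSpace D]
    [TopologicalSpace D] {P : Measure Ω} [IsFiniteMeasure P] {F : T → Ω → ℝ} {Z : Ω → D}
    (hZ : (P.map Z).IsOpenPosMeasure) {z₀ : D} {Q Q' : Measure (T → ℝ)}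
    (hQ : IsPosteriorLaw P F Z z₀ Q) (hQ' : IsPosteriorLaw P F Z z₀ Q') : Q = Q' := by
  obtain ⟨κ, _, hκ, hc, rfl⟩ := hQ
  obtain ⟨η, _, hη, hd, rfl⟩ := hQ'
  -- Almost-everywhere uniqueness of kernels is applied to finite-dimensional marginals, whose
  -- σ-algebra is countably generated; that of `T → ℝ` need not be.
  have hfdd (I : Finset T) : (κ z₀).map I.restrict = (η z₀).map I.restrict := by
    have hI : Measurable (I.restrict : (T → ℝ) → I → ℝ) := Finset.measurable_restrict I
    have hae : κ.map I.restrict =ᵐ[P.map Z] η.map I.restrict :=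
      Kernel.ae_eq_of_compProd_eq ((hκ.comp_left hI).map_eq.symm.trans (hη.comp_left hI).map_eq)
    have := Measure.isProbabilityMeasure_map (μ := κ z₀) hI.aemeasurable
    have := Measure.isProbabilityMeasure_map (μ := η z₀) hI.aemeasurable
    refine ext_of_forall_integral_eq_of_IsFiniteMeasure fun g => ?_
    rw [integral_map hI.aemeasurable (by fun_prop), integral_map hI.aemeasurable (by fun_prop)]
    refine congrFun (((hc I g).ae_eq_iff_eq (P.map Z) (hd I g)).1 ?_) z₀
    filter_upwards [hae] with z hz
    rw [Kernel.map_apply _ hI, Kernel.map_apply _ hI] at hz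
    rw [← integral_map (φ := I.restrict) hI.aemeasurable (by fun_prop), hz,
      integral_map hI.aemeasurable (by fun_prop)]
  have (I : Finset T) : IsFiniteMeasure ((κ z₀).map I.restrict) := inferInstance
  exact IsProjectiveLimit.unique (P := fun I => (κ z₀).map I.restrict) (fun I => rfl)
    fun I => (hfdd I).symm

/-- If `F = A (Z) + G` with `G` independent of `Z` and `A` continuous, then the law of `A z₀ + G`
is a posterior law of `F` given `Z = z₀`. -/
lemma isPosteriorLaw_add_of_indepFun {Ω D T : Type*} [MeasurableSpace Ω] [MeasurableSpace D]
    [TopologicalSpace D] [OpensMeasurableSpace D] [FirstCountableTopology D]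
    {P : Measure Ω} [IsProbabilityMeasure P]
    {G : T → Ω → ℝ} {Z : Ω → D} {A : D → T → ℝ} (hG : ∀ t, Measurable (G t))
    (hZ : Measurable Z) (hA : ∀ t, Continuous fun z => A z t)
    (hind : IndepFun (fun ω t => G t ω) Z P) (z₀ : D) :
    IsPosteriorLaw P (fun t ω => A (Z ω) t + G t ω) Z z₀
      (P.map fun ω t => A z₀ t + G t ω) := by
  have hG' : Measurable fun ω t => G t ω := measurable_pi_lambda _ hG
  set L := P.map fun ω t => G t ω with hL
  have : IsProbabilityMeasure L := Measure.isProbabilityMeasure_map hG'.aemeasurable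
  have hf : Measurable fun p : D × (T → ℝ) => fun t => A p.1 t + p.2 t :=
    measurable_pi_lambda _ fun t =>
      ((hA t).measurable.comp measurable_fst).add ((measurable_pi_apply t).comp measurable_snd)
  -- By independence, the conditional law of `(Z, G)` given `Z = z` is `δ_z ⊗ L`; its image under
  -- `(z, g) ↦ A z + g` is the desired kernel.
  have hid : HasCondDistrib (fun ω => (Z ω, fun t => G t ω)) Z
      (Kernel.id ×ₖ Kernel.const D L) P := by
    refine ⟨by fun_prop, ?_⟩
    have hpair : P.map (fun ω => (Z ω, fun t => G t ω)) = (P.map Z).prod L :=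
      (indepFun_iff_map_prod_eq_prod_map_map hZ.aemeasurable hG'.aemeasurable).1 hind.symm
    have : P.map (fun ω => (Z ω, (Z ω, fun t => G t ω))) =
        ((P.map Z).prod L).map fun p => (p.1, p) := by
      rw [← hpair, Measure.map_map (by fun_prop) (by fun_prop)]
      rfl
    rw [this]
    ext s hs
    rw [Measure.map_apply (by fun_prop) hs, Measure.compProd_apply hs,
      Measure.prod_apply ((by fun_prop : Measurable fun p : D × (T → ℝ) => (p.1, p)) hs)]
    refine lintegral_congr fun z => ?_
    rw [Kernel.prod_apply, Kernel.id_apply, Kernel.const_apply, Measure.dirac_prod,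
      Measure.map_apply (by fun_prop) (measurable_prodMk_left hs)]
    rfl
  have hκ (z : D) : (Kernel.id ×ₖ Kernel.const D L).map (fun p t => A p.1 t + p.2 t) z =
      P.map fun ω t => A z t + G t ω := by
    rw [Kernel.map_apply _ hf, Kernel.prod_apply, Kernel.id_apply, Kernel.const_apply,
      Measure.dirac_prod, Measure.map_map hf (by fun_prop), hL, Measure.map_map (by fun_prop) hG']
    rfl
  refine ⟨_, Kernel.IsMarkovKernel.map _ hf, hid.comp_left hf, fun I g => ?_, hκ z₀⟩
  have hm (z : D) : Measurable fun ω t => A z t + G t ω :=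
    measurable_pi_lambda _ fun t => (hG t).const_add _
  have hgm : Measurable fun f : T → ℝ => g (I.restrict f) :=
    g.continuous.measurable.comp (Finset.measurable_restrict I)
  simp_rw [hκ]
  have (z : D) : ∫ f, g (I.restrict f) ∂(P.map fun ω t => A z t + G t ω) =
      ∫ ω, g (I.restrict fun t => A z t + G t ω) ∂P :=
    integral_map (hm z).aemeasurable hgm.aestronglyMeasurable
  simp_rw [this]
  refine continuous_of_dominated (bound := fun _ => ‖g‖)
    (fun z => (hgm.comp (hm z)).aestronglyMeasurable)
    (fun z => Filter.Eventually.of_forall fun ω => g.norm_coe_le_norm _)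
    (integrable_const _) (Filter.Eventually.of_forall fun ω => g.continuous.comp ?_)
  exact continuous_pi fun t => (hA t).add continuous_const

/-! ### Gaussian process regression. -/

section Regression

variable {Ω T : Type*} [MeasurableSpace Ω] {P : Measure Ω}

/-- Finite linear combinations of a Gaussian process form a Gaussian process. -/
lemma isGaussianProcess_of_mem_span {S : Type*} {X : T → Ω → ℝ} (hX : IsGaussianProcess X P)
    {Y : S → Ω → ℝ} (h : ∀ s, Y s ∈ Submodule.span ℝ (Set.range X)) :
    IsGaussianProcess Y P := by
  refine hX.of_isGaussianProcess fun s => ?_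
  obtain ⟨c, hc⟩ := (Finsupp.mem_span_range_iff_exists_finsupp).1 (h s)
  refine ⟨c.support, ∑ t : c.support, c t • ContinuousLinearMap.proj t, fun ω => ?_⟩
  rw [← hc, Finsupp.sum, ← Finset.sum_coe_sort]
  simp

lemma isGaussianProcess_const_add {X : T → Ω → ℝ} (hX : IsGaussianProcess X P) (a : T → ℝ) :
    IsGaussianProcess (fun t ω => a t + X t ω) P where
  hasGaussianLaw I := by
    have := (hX.hasGaussianLaw I).isGaussian_map
    refine ⟨?_⟩
    have : P.map (fun ω => I.restrict fun t => a t + X t ω) =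
        (P.map fun ω => I.restrict (X · ω)).map fun f => I.restrict a + f := by
      rw [AEMeasurable.map_map_of_aemeasurable (by fun_prop) (hX.hasGaussianLaw I).aemeasurable]
      rfl
    rw [this]
    infer_instance

lemma IsGP.isGPLaw_map {X : T → Ω → ℝ} {m : T → ℝ} {K : T → T → ℝ} (h : IsGP X m K P) :
    IsGPLaw (P.map fun ω t => X t ω) m K := by
  have hX : Measurable fun ω t => X t ω := measurable_pi_lambda _ h.measurable
  refine ⟨measurable_pi_apply, ⟨fun I => ⟨?_⟩⟩, fun t => ?_, fun s t => ?_⟩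
  · have := (h.gaussian.hasGaussianLaw I).isGaussian_map
    rwa [Measure.map_map (Finset.measurable_restrict I) hX]
  · rw [integral_map hX.aemeasurable (measurable_pi_apply t).aestronglyMeasurable, h.mean]
  · rw [covariance_map_fun (measurable_pi_apply s).aestronglyMeasurable
      (measurable_pi_apply t).aestronglyMeasurable hX.aemeasurable, h.cov]

/-- Gaussian process regression: if `c t` solves the normal equations for the regression of `F t`
on the Gaussian vector `Z`, then the posterior law of `F` given `Z = z₀` is a Gaussian process
law. -/
lemma exists_isPosteriorLaw_isGPLaw {ι κ : Type*} [Fintype ι] [Fintype κ]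
    {F : T → Ω → ℝ} {Z : Ω → ι → κ → ℝ}
    (hF : ∀ t, Measurable (F t)) (hZ : Measurable Z)
    (hFZ : IsGaussianProcess (Sum.elim F fun (p : ι × κ) ω => Z ω p.1 p.2) P)
    (hF0 : ∀ t, P[F t] = 0) (hZ0 : ∀ i j, P[fun ω => Z ω i j] = 0)
    (c : T → ι × κ → ℝ)
    (hc : ∀ t i j, ∑ p, c t p * cov[fun ω => Z ω p.1 p.2, fun ω => Z ω i j; P] =
      cov[F t, fun ω => Z ω i j; P]) (z₀ : ι → κ → ℝ) :
    ∃ Q, IsPosteriorLaw P F Z z₀ Q ∧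
      IsGPLaw Q (fun t => ∑ p, c t p * z₀ p.1 p.2)
        (fun s t => cov[F s, F t; P] - ∑ p, c s p * cov[fun ω => Z ω p.1 p.2, F t; P]) := by
  have hP : IsProbabilityMeasure P := hFZ.isProbabilityMeasure
  have hFL (t : T) : MemLp (F t) 2 P := (hFZ.hasGaussianLaw_eval (.inl t)).memLp_two
  have hZL (p : ι × κ) : MemLp (fun ω => Z ω p.1 p.2) 2 P :=
    (hFZ.hasGaussianLaw_eval (.inr p)).memLp_two
  have hZm (p : ι × κ) : Measurable fun ω => Z ω p.1 p.2 := by fun_prop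
  set A : (ι → κ → ℝ) → T → ℝ := fun z t => ∑ p, c t p * z p.1 p.2 with hA
  set G : T → Ω → ℝ := fun t ω => F t ω - A (Z ω) t with hG
  have hAL (t : T) : MemLp (fun ω => A (Z ω) t) 2 P :=
    memLp_finsetSum _ fun p _ => (hZL p).const_mul _
  have hGL (t : T) : MemLp (G t) 2 P := (hFL t).sub (hAL t)
  have hAm (t : T) : Measurable fun ω => A (Z ω) t :=
    Finset.measurable_sum _ fun p _ => (hZm p).const_mul _
  have hGm (t : T) : Measurable (G t) := (hF t).sub (hAm t)
  have hAcov (t : T) {Y : Ω → ℝ} (hY : MemLp Y 2 P) :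
      cov[fun ω => A (Z ω) t, Y; P] = ∑ p, c t p * cov[fun ω => Z ω p.1 p.2, Y; P] := by
    rw [hA, covariance_fun_sum_left (fun p => (hZL p).const_mul _) hY]
    simp_rw [covariance_const_mul_left]
  -- The normal equations say exactly that the residual is uncorrelated with the observation.
  have hGZ (t : T) (p : ι × κ) : cov[G t, fun ω => Z ω p.1 p.2; P] = 0 := by
    rw [hG, covariance_fun_sub_left (hFL t) (hAL t) (hZL p), hAcov t (hZL p), hc, sub_self]
  have hjoint : IsGaussianProcess (Sum.elim G fun (p : ι × κ) ω => Z ω p.1 p.2) P := by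
    refine isGaussianProcess_of_mem_span hFZ ?_
    rintro (t | p)
    · have : G t = F t - ∑ p, c t p • fun ω => Z ω p.1 p.2 := by
        ext ω
        simp [hG, hA]
      rw [Sum.elim_inl, this]
      exact Submodule.sub_mem _ (Submodule.subset_span ⟨.inl t, rfl⟩)
        (Submodule.sum_mem _ fun p _ =>
          Submodule.smul_mem _ _ (Submodule.subset_span ⟨.inr p, rfl⟩))
    · exact Submodule.subset_span ⟨.inr p, rfl⟩
  have hind : IndepFun (fun ω t => G t ω) Z P := by
    have h := hjoint.indepFun_of_covariance_eq_zero (fun t => (hGm t).aemeasurable)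
      (fun p => (hZm p).aemeasurable) hGZ
    exact h.comp (ψ := fun (w : ι × κ → ℝ) i j => w (i, j)) measurable_id (by fun_prop)
  have hpost := isPosteriorLaw_add_of_indepFun hGm hZ
    (fun t => (by fun_prop : Continuous fun z => A z t)) hind z₀
  have hFG : (fun t ω => A (Z ω) t + G t ω) = F := by
    ext t ω
    simp [hG]
  rw [hFG] at hpost
  have hG0 (t : T) : P[G t] = 0 := by
    rw [hG, integral_sub ((hFL t).integrable one_le_two) ((hAL t).integrable one_le_two), hF0, hA,
      integral_finsetSum _ fun p _ => ((hZL p).const_mul _).integrable one_le_two]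
    simp_rw [integral_const_mul, hZ0]
    simp
  refine ⟨_, hpost, IsGP.isGPLaw_map ⟨fun t => (hGm t).const_add _,
    isGaussianProcess_const_add (hjoint.comp_right Sum.inl) (A z₀), fun t => ?_, fun s t => ?_⟩⟩
  · rw [integral_add (integrable_const _) ((hGL t).integrable one_le_two), hG0]
    simp [hA]
  · rw [covariance_const_add_left ((hGL s).integrable one_le_two),
      covariance_const_add_right ((hGL t).integrable one_le_two)]
    -- Since `G` is orthogonal to every linear function of `Z`, `cov[G s, G t]` reduces to `cov[G s,
    -- F t]`.
    have h1 : cov[G s, fun ω => A (Z ω) t; P] = 0 := by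
      rw [covariance_comm, hAcov t (hGL s)]
      refine Finset.sum_eq_zero fun p _ => ?_
      rw [covariance_comm, hGZ, mul_zero]
    have h2 : cov[G s, G t; P] = cov[G s, F t; P] - cov[G s, fun ω => A (Z ω) t; P] :=
      covariance_fun_sub_right (hGL s) (hFL t) (hAL t)
    rw [h2, h1, sub_zero, hG, covariance_fun_sub_left (hFL s) (hAL s) (hFL t), hAcov s (hFL t)]

end Regression

/-! ### Positivity of the self-convolution. -/

/-- The self-convolution of a kernel has positive semidefinite Gram matrices. -/
lemma posSemidef_gram_selfConv {S : Type*} [MeasurableSpace S] {ν : Measure S} {k : S → S → ℝ}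
    (hk : IsKernel k) (hk2 : ∀ t, MemLp (k t) 2 ν) {n : ℕ} (y : Fin n → S) :
    (gram (selfConv ν k) y y).PosSemidef := by
  have hsymm (s t : S) : k s t = k t s := by simpa using hk.isHermitian.apply t s
  have hint (s t : S) : Integrable (fun u => k s u * k u t) ν := by
    simp_rw [hsymm _ t]
    exact (hk2 s).integrable_mul (hk2 t)
  have hint' (c : Fin n → ℝ) (i j : Fin n) :
      Integrable (fun u => c i * k (y i) u * (c j * k (y j) u)) ν := by
    refine ((hint (y i) (y j)).const_mul (c i * c j)).congr (.of_forall fun u => ?_)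
    simp only [hsymm u]
    ring
  refine Matrix.PosSemidef.of_dotProduct_mulVec_nonneg ?_ fun c => ?_
  · ext i j
    simp [gram, selfConv, hsymm, mul_comm]
  -- The quadratic form is the squared `L²(ν)` norm of `∑ c_i k(y_i, ·)`.
  · have : star c ⬝ᵥ gram (selfConv ν k) y y *ᵥ c = ∫ u, (∑ i, c i * k (y i) u) ^ 2 ∂ν := by
      simp_rw [sq, Finset.sum_mul_sum]
      rw [integral_finsetSum _ fun i _ => integrable_finsetSum _ fun j _ => hint' c i j]
      simp only [dotProduct, Matrix.mulVec, gram, selfConv, Matrix.of_apply, Finset.mul_sum]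
      refine Finset.sum_congr rfl fun i _ => ?_
      rw [integral_finsetSum _ fun j _ => hint' c i j]
      refine Finset.sum_congr rfl fun j _ => ?_
      rw [mul_comm (integral _ _), ← mul_assoc, ← integral_const_mul]
      refine integral_congr_ae (.of_forall fun u => ?_)
      simp only [Pi.star_apply, star_trivial, hsymm u]
      ring
    rw [this]
    exact integral_nonneg fun u => sq_nonneg _

/-! ### Joint Gaussianity and covariances of the model. -/

namespace IsBayesCMEModel

variable {Ω S T : Type*} [MeasurableSpace Ω] {n m : ℕ} {kx : S → S → ℝ} {r : T → T → ℝ}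
  {μ : S × T → Ω → ℝ} {ε : Fin n → T → Ω → ℝ} {P : Measure Ω}

/-- Separate Gaussianity does not give joint Gaussianity; independence of the noises from each other
and from the prior does. -/
lemma isGaussianProcess (h : IsBayesCMEModel kx r μ ε P) :
    IsGaussianProcess (Sum.elim μ fun (q : Fin n × T) => ε q.1 q.2) P where
  hasGaussianLaw I := by
    classical
    -- All noise functions are restricted to one common finite set `J` of points. The coordinates in
    -- `I` are then linear functionals of the larger Gaussian vector.
    set J := I.toRight.image Prod.snd
    have hε : HasGaussianLaw (fun ω i => J.restrict (ε i · ω)) P :=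
      iIndepFun.hasGaussianLaw (fun i => (h.noise i).gaussian.hasGaussianLaw J)
        (h.noise_indep.comp (fun _ => J.restrict) fun _ => Finset.measurable_restrict J)
    have hμε := IndepFun.hasGaussianLaw (h.prior.gaussian.hasGaussianLaw I.toLeft) hε
      (h.prior_indep_noise.comp (Finset.measurable_restrict I.toLeft)
        (measurable_pi_lambda _ fun i =>
          (Finset.measurable_restrict J).comp (measurable_pi_apply i) :
          Measurable fun (e : Fin n → T → ℝ) i => J.restrict (e i)))
    have hL (s : I) : ∃ L : (I.toLeft → ℝ) × (Fin n → J → ℝ) →L[ℝ] ℝ, ∀ ω,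
        Sum.elim μ (fun (q : Fin n × T) => ε q.1 q.2) s ω =
          L (I.toLeft.restrict (μ · ω), fun i => J.restrict (ε i · ω)) := by
      obtain ⟨p | q, hs⟩ := s
      · exact ⟨(ContinuousLinearMap.proj (R := ℝ) (φ := fun _ : I.toLeft => ℝ)
          ⟨p, Finset.mem_toLeft.2 hs⟩).comp (ContinuousLinearMap.fst ℝ _ _), fun ω => rfl⟩
      · exact ⟨((ContinuousLinearMap.proj (R := ℝ) (φ := fun _ : J => ℝ)
          ⟨q.2, Finset.mem_image_of_mem _ (Finset.mem_toRight.2 hs)⟩).comp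
          (ContinuousLinearMap.proj (φ := fun _ : Fin n => J → ℝ) q.1)).comp
          (ContinuousLinearMap.snd ℝ _ _), fun ω => rfl⟩
    choose L hL using hL
    refine (hμε.map_fun (ContinuousLinearMap.pi L)).congr (.of_forall fun ω => ?_)
    ext s
    exact (hL s ω).symm

lemma memLp_prior (h : IsBayesCMEModel kx r μ ε P) (p : S × T) : MemLp (μ p) 2 P :=
  (h.prior.gaussian.hasGaussianLaw_eval p).memLp_two

lemma memLp_noise (h : IsBayesCMEModel kx r μ ε P) (i : Fin n) (t : T) : MemLp (ε i t) 2 P :=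
  ((h.noise i).gaussian.hasGaussianLaw_eval t).memLp_two

lemma cov_prior_noise (h : IsBayesCMEModel kx r μ ε P) (p : S × T) (i : Fin n) (t : T) :
    cov[μ p, ε i t; P] = 0 := by
  have := h.prior.gaussian.isProbabilityMeasure
  exact (h.prior_indep_noise.comp (φ := fun f : S × T → ℝ => f p)
    (ψ := fun e : Fin n → T → ℝ => e i t) (by fun_prop) (by fun_prop)).covariance_eq_zero
    (h.memLp_prior p) (h.memLp_noise i t)

lemma cov_noise (h : IsBayesCMEModel kx r μ ε P) (i j : Fin n) (s t : T) :
    cov[ε i s, ε j t; P] = (1 : Matrix (Fin n) (Fin n) ℝ) i j * r s t := by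
  have := h.prior.gaussian.isProbabilityMeasure
  obtain rfl | hij := eq_or_ne i j
  · simp [(h.noise i).cov]
  · rw [Matrix.one_apply_ne hij, zero_mul]
    exact ((h.noise_indep.indepFun hij).comp (φ := fun f : T → ℝ => f s)
      (ψ := fun f : T → ℝ => f t) (by fun_prop) (by fun_prop)).covariance_eq_zero
      (h.memLp_noise i s) (h.memLp_noise j t)

lemma cov_prior_response (h : IsBayesCMEModel kx r μ ε P) (lam : ℝ) (x : Fin n → S)
    (y : Fin n → T) (p : S × T) (k l : Fin n) :
    cov[μ p, fun ω => response lam x y μ ε ω k l; P] = kx p.1 (x k) * r p.2 (y l) := by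
  have := h.prior.gaussian.isProbabilityMeasure
  have h1 : cov[μ p, μ (x k, y l) + fun ω => √lam * ε k (y l) ω; P] =
      kx p.1 (x k) * r p.2 (y l) := by
    rw [covariance_add_right (h.memLp_prior _) (h.memLp_prior _) ((h.memLp_noise _ _).const_mul _),
      covariance_const_mul_right, h.cov_prior_noise, h.prior.cov]
    simp [tensorKernel]
  exact h1

lemma memLp_response (h : IsBayesCMEModel kx r μ ε P) (lam : ℝ) (x : Fin n → S)
    (y : Fin n → T) (k l : Fin n) : MemLp (fun ω => response lam x y μ ε ω k l) 2 P :=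
  (h.memLp_prior _).add ((h.memLp_noise _ _).const_mul _)

/-- Prior and noise contribute `K_xx ⊗ R` and `λI ⊗ R`; the common factor `R` makes the sum a single
Kronecker product. -/
lemma cov_response (h : IsBayesCMEModel kx r μ ε P) {lam : ℝ} (hlam : 0 ≤ lam) (x : Fin n → S)
    (y : Fin n → T) (i j k l : Fin n) :
    cov[fun ω => response lam x y μ ε ω i j, fun ω => response lam x y μ ε ω k l; P] =
      (gram kx x x + lam • (1 : Matrix (Fin n) (Fin n) ℝ)) i k * gram r y y j l := by
  have := h.prior.gaussian.isProbabilityMeasure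
  have hε (i j : Fin n) : MemLp (fun ω => √lam * ε i (y j) ω) 2 P :=
    (h.memLp_noise _ _).const_mul _
  have h1 : cov[μ (x i, y j) + fun ω => √lam * ε i (y j) ω,
      fun ω => response lam x y μ ε ω k l; P] =
      (gram kx x x + lam • (1 : Matrix (Fin n) (Fin n) ℝ)) i k * gram r y y j l := by
    rw [covariance_add_left (h.memLp_prior _) (hε i j) (h.memLp_response ..),
      h.cov_prior_response, covariance_const_mul_left]
    have h2 : cov[ε i (y j), fun ω => response lam x y μ ε ω k l; P] =
        cov[ε i (y j), μ (x k, y l) + fun ω => √lam * ε k (y l) ω; P] := rfl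
    rw [h2, covariance_add_right (h.memLp_noise _ _) (h.memLp_prior _) (hε k l), covariance_comm,
      h.cov_prior_noise, covariance_const_mul_right, h.cov_noise, zero_add, ← mul_assoc,
      Real.mul_self_sqrt hlam]
    simp [gram]
    ring
  exact h1

lemma cov_cfme_response (h : IsBayesCMEModel kx r μ ε P) (lam : ℝ) (x : Fin n → S)
    (y : Fin n → T) (x' : Fin m → S) (t : T) (k l : Fin n) :
    cov[cfme x' μ t, fun ω => response lam x y μ ε ω k l; P] =
      1 / (m : ℝ) * ∑ j, kx (x' j) (x k) * r t (y l) := by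
  have := h.prior.gaussian.isProbabilityMeasure
  simp only [← h.cov_prior_response lam x y (_, t)]
  rw [← covariance_fun_sum_left (fun j => h.memLp_prior _) (h.memLp_response ..),
    ← covariance_const_mul_left]
  rfl

lemma cov_cfme (h : IsBayesCMEModel kx r μ ε P) (x' : Fin m → S) (s t : T) :
    cov[cfme x' μ s, cfme x' μ t; P] =
      1 / (m : ℝ) ^ 2 * ∑ i, ∑ j, kx (x' i) (x' j) * r s t := by
  have := h.prior.gaussian.isProbabilityMeasure
  have h1 : cov[cfme x' μ s, cfme x' μ t; P] =
      1 / (m : ℝ) * (1 / (m : ℝ) * ∑ i, ∑ j, cov[μ (x' i, s), μ (x' j, t); P]) := by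
    rw [← covariance_fun_sum_fun_sum (fun j => h.memLp_prior _) (fun j => h.memLp_prior _),
      ← covariance_const_mul_right, ← covariance_const_mul_left]
    rfl
  rw [h1]
  simp only [h.prior.cov, tensorKernel]
  ring

end IsBayesCMEModel

/-! ### Matrix identities for the regression weights. -/

/-- Weights of the responses in the posterior mean of the counterfactual mean embedding. -/
noncomputable def regressionWeight {S T : Type*} {n m : ℕ} (kx : S → S → ℝ) (r : T → T → ℝ)
    (lam : ℝ) (x : Fin n → S) (y : Fin n → T) (x' : Fin m → S) (t : T) (p : Fin n × Fin n) : ℝ :=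
  1 / (m : ℝ) *
    ((1 : Fin m → ℝ) ᵥ*
      (gram kx x' x * (gram kx x x + lam • (1 : Matrix (Fin n) (Fin n) ℝ))⁻¹)) p.1 *
    ((gram r y y)⁻¹ *ᵥ fun j => r (y j) t) p.2

section Matrices

variable {S T : Type*} {n m : ℕ} {kx : S → S → ℝ} {r : T → T → ℝ} {lam : ℝ}
  {x : Fin n → S} {y : Fin n → T} {x' : Fin m → S}

/-- The weights are a product of a function of `p.1` and one of `p.2`, so summing against another
product splits into two dot products. Both the normal equations and the posterior covariance rest on
this. -/
lemma sum_regressionWeight_mul (t : T) (a b : Fin n → ℝ) :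
    ∑ p, regressionWeight kx r lam x y x' t p * (a p.1 * b p.2) =
      1 / (m : ℝ) *
        ((1 : Fin m → ℝ) ᵥ*
          (gram kx x' x * (gram kx x x + lam • (1 : Matrix (Fin n) (Fin n) ℝ))⁻¹) ⬝ᵥ a) *
        (((gram r y y)⁻¹ *ᵥ fun j => r (y j) t) ⬝ᵥ b) := by
  rw [dotProduct, dotProduct, mul_assoc, Finset.sum_mul_sum, Finset.mul_sum, Fintype.sum_prod_type]
  refine Finset.sum_congr rfl fun i _ => ?_
  rw [Finset.mul_sum]
  refine Finset.sum_congr rfl fun j _ => ?_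
  rw [regressionWeight]
  ring

lemma sum_regressionWeight_mul_observed {ky : T → T → ℝ} (hky : ∀ s t, ky s t = ky t s) (t : T) :
    ∑ p, regressionWeight kx r lam x y x' t p * observed ky y p.1 p.2 =
      postMean kx ky r lam x y x' t := by
  rw [postMean, ← Matrix.mulVec_mulVec, ← Matrix.mulVec_mulVec, Matrix.dotProduct_mulVec,
    dotProduct, Finset.mul_sum, Fintype.sum_prod_type]
  refine Finset.sum_congr rfl fun i _ => ?_
  simp only [Matrix.mulVec, dotProduct, Finset.mul_sum, regressionWeight, observed, gram,
    -- `observed` carries the transposed indices of `gram ky y y`; symmetry of `ky` reconciles them.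
    Matrix.of_apply, hky (y i)]
  refine Finset.sum_congr rfl fun j _ => ?_
  simp only [Finset.sum_mul]
  refine Finset.sum_congr rfl fun k _ => ?_
  ring

/-- The normal equations. -/
lemma sum_regressionWeight_mul_cov (hr : ∀ s t, r s t = r t s)
    (hM : IsUnit (gram kx x x + lam • (1 : Matrix (Fin n) (Fin n) ℝ)).det)
    (hR : IsUnit (gram r y y).det) (t : T) (k l : Fin n) :
    ∑ p, regressionWeight kx r lam x y x' t p *
        ((gram kx x x + lam • (1 : Matrix (Fin n) (Fin n) ℝ)) p.1 k * gram r y y p.2 l) =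
      1 / (m : ℝ) * ∑ j, kx (x' j) (x k) * r t (y l) := by
  rw [sum_regressionWeight_mul t (fun i => (gram kx x x + lam • 1) i k) fun j => gram r y y j l]
  have h1 : ((1 : Fin m → ℝ) ᵥ*
      (gram kx x' x * (gram kx x x + lam • (1 : Matrix (Fin n) (Fin n) ℝ))⁻¹) ⬝ᵥ
        fun i => (gram kx x x + lam • 1) i k) = ∑ j, kx (x' j) (x k) := by
    change ((1 : Fin m → ℝ) ᵥ* _ ᵥ* (gram kx x x + lam • (1 : Matrix (Fin n) (Fin n) ℝ))) k = _
    rw [Matrix.vecMul_vecMul, Matrix.nonsing_inv_mul_cancel_right _ _ hM]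
    simp [Matrix.vecMul, dotProduct, gram]
  have h2 : ((gram r y y)⁻¹ *ᵥ fun j => r (y j) t) ⬝ᵥ (fun j => gram r y y j l) = r t (y l) := by
    have : (fun j => gram r y y j l) = gram r y y l := funext fun j => hr _ _
    rw [this, dotProduct_comm]
    change (gram r y y *ᵥ ((gram r y y)⁻¹ *ᵥ fun j => r (y j) t)) l = _
    rw [Matrix.mulVec_mulVec, Matrix.mul_nonsing_inv _ hR, Matrix.one_mulVec, hr]
  rw [h1, h2, ← Finset.sum_mul, mul_assoc]

lemma sub_sum_regressionWeight_eq_postCov (hkx : ∀ s t, kx s t = kx t s)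
    (hr : ∀ s t, r s t = r t s) (s t : T) :
    1 / (m : ℝ) ^ 2 * ∑ i, ∑ j, kx (x' i) (x' j) * r s t -
        ∑ p, regressionWeight kx r lam x y x' s p *
          (1 / (m : ℝ) * ∑ j, kx (x' j) (x p.1) * r t (y p.2)) =
      postCov kx r lam x y x' s t := by
  have h1 : ∑ p, regressionWeight kx r lam x y x' s p *
      (1 / (m : ℝ) * ∑ j, kx (x' j) (x p.1) * r t (y p.2)) =
      1 / (m : ℝ) * ∑ p, regressionWeight kx r lam x y x' s p *
        ((gram kx x x' *ᵥ (1 : Fin m → ℝ)) p.1 * r t (y p.2)) := by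
    rw [Finset.mul_sum]
    refine Finset.sum_congr rfl fun p _ => ?_
    simp only [← Finset.sum_mul, Matrix.mulVec, dotProduct, gram, Matrix.of_apply, Pi.one_apply,
      mul_one, hkx (x p.1)]
    ring
  -- The inverse of the symmetric matrix `R_yy` is symmetric, so it may be moved from the `s` side
  -- to the `t` side.
  have h2 : ((gram r y y)⁻¹ *ᵥ fun j => r (y j) s) ⬝ᵥ (fun j => r t (y j)) =
      (fun j => r s (y j)) ⬝ᵥ ((gram r y y)⁻¹ *ᵥ fun j => r (y j) t) := by
    have hsymm : (gram r y y)ᵀ = gram r y y := by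
      ext i j
      exact hr _ _
    rw [Matrix.dotProduct_mulVec, ← Matrix.mulVec_transpose, Matrix.transpose_nonsing_inv, hsymm]
    simp only [hr s, hr t]
  have h3 : ∑ i, ∑ j, kx (x' i) (x' j) * r s t =
      r s t * ((1 : Fin m → ℝ) ⬝ᵥ gram kx x' x' *ᵥ (1 : Fin m → ℝ)) := by
    simp [dotProduct, Matrix.mulVec, gram, mul_comm, Finset.mul_sum]
  rw [h1, sum_regressionWeight_mul s (gram kx x x' *ᵥ 1) fun j => r t (y j), h2, h3, postCov,
    Matrix.sub_mulVec, Matrix.smul_mulVec, Matrix.smul_mulVec, dotProduct_sub, dotProduct_smul,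
    dotProduct_smul, ← Matrix.dotProduct_mulVec, Matrix.mulVec_mulVec, smul_eq_mul, smul_eq_mul]
  ring

end Matrices

end BayesCFME

/-! ### Assembly. -/

theorem mainTheorem1 {Ω 𝒳 𝒴 : Type*} [MeasurableSpace Ω] [MeasurableSpace 𝒴]
    (P : Measure Ω) [IsProbabilityMeasure P]
    (ν : Measure 𝒴) [IsFiniteMeasure ν]
    (kx : 𝒳 → 𝒳 → ℝ) (ky : 𝒴 → 𝒴 → ℝ)
    (hkx : BayesCFME.IsKernel kx) (hky : BayesCFME.IsKernel ky)
    (hky2 : ∀ t, MemLp (ky t) 2 ν)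
    (r : 𝒴 → 𝒴 → ℝ) (hr : r = BayesCFME.selfConv ν ky)
    (lam : ℝ) (hlam : 0 < lam)
    {n m : ℕ} (hm : 0 < m)
    (x : Fin n → 𝒳) (y : Fin n → 𝒴) (x' : Fin m → 𝒳)
    (hR : IsUnit (BayesCFME.gram r y y).det)
    (μ : 𝒳 × 𝒴 → Ω → ℝ) (ε : Fin n → 𝒴 → Ω → ℝ)
    (hmodel : BayesCFME.IsBayesCMEModel kx r μ ε P) :
    ∃ Q : Measure (𝒴 → ℝ),
      (∀ Q' : Measure (𝒴 → ℝ),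
        BayesCFME.IsPosteriorLaw P (BayesCFME.cfme x' μ) (BayesCFME.response lam x y μ ε)
          (BayesCFME.observed ky y) Q' ↔ Q' = Q) ∧
      BayesCFME.IsGPLaw Q
        (BayesCFME.postMean kx ky r lam x y x')
        (BayesCFME.postCov kx r lam x y x') := by
  have hkxs (s t : 𝒳) : kx s t = kx t s := by simpa using hkx.isHermitian.apply t s
  have hkys (s t : 𝒴) : ky s t = ky t s := by simpa using hky.isHermitian.apply t s
  have hrs (s t : 𝒴) : r s t = r t s := by
    simp only [hr, BayesCFME.selfConv]
    refine integral_congr_ae (.of_forall fun u => ?_)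
    simp only [hkys u, mul_comm]
  have hM : (BayesCFME.gram kx x x + lam • (1 : Matrix (Fin n) (Fin n) ℝ)).PosDef :=
    Matrix.PosDef.posSemidef_add (hkx.submatrix x) (Matrix.PosDef.one.smul hlam)
  have hRpos : (BayesCFME.gram r y y).PosDef := by
    have h : (BayesCFME.gram r y y).PosSemidef := by
      rw [hr]
      exact BayesCFME.posSemidef_gram_selfConv hky hky2 y
    -- A positive semidefinite matrix is positive definite exactly when it is invertible.
    exact h.posDef_iff_isUnit.2 ((Matrix.isUnit_iff_isUnit_det _).2 hR)
  have hMdet := (Matrix.isUnit_iff_isUnit_det _).1 hM.isUnit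
  have hZm : Measurable (BayesCFME.response lam x y μ ε) :=
    measurable_pi_lambda _ fun i => measurable_pi_lambda _ fun j =>
      (hmodel.prior.measurable _).add (((hmodel.noise i).measurable _).const_mul _)
  have hFm (t : 𝒴) : Measurable (BayesCFME.cfme x' μ t) :=
    (Finset.measurable_sum _ fun j _ => hmodel.prior.measurable _).const_mul _
  have hFZ : IsGaussianProcess (Sum.elim (BayesCFME.cfme x' μ) fun (p : Fin n × Fin n) ω =>
      BayesCFME.response lam x y μ ε ω p.1 p.2) P := by
    refine BayesCFME.isGaussianProcess_of_mem_span hmodel.isGaussianProcess ?_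
    rintro (t | p)
    · have : BayesCFME.cfme x' μ t = (1 / (m : ℝ)) • ∑ j, μ (x' j, t) := by
        ext ω
        simp [BayesCFME.cfme]
      rw [Sum.elim_inl, this]
      exact Submodule.smul_mem _ _ (Submodule.sum_mem _ fun j _ =>
        Submodule.subset_span ⟨.inl (x' j, t), rfl⟩)
    · exact Submodule.add_mem _ (Submodule.subset_span ⟨.inl (x p.1, y p.2), rfl⟩)
        (Submodule.smul_mem _ √lam (Submodule.subset_span ⟨.inr (p.1, y p.2), rfl⟩))
  have hZ0 (i j : Fin n) : P[fun ω => BayesCFME.response lam x y μ ε ω i j] = 0 := by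
    simp only [BayesCFME.response]
    rw [integral_add ((hmodel.memLp_prior _).integrable one_le_two)
      (((hmodel.memLp_noise _ _).const_mul _).integrable one_le_two), integral_const_mul,
      hmodel.prior.mean, (hmodel.noise i).mean]
    simp
  have hF0 (t : 𝒴) : P[BayesCFME.cfme x' μ t] = 0 := by
    simp only [BayesCFME.cfme]
    rw [integral_const_mul, integral_finsetSum _ fun j _ =>
      (hmodel.memLp_prior _).integrable one_le_two]
    simp [hmodel.prior.mean]
  have hsupp : (P.map (BayesCFME.response lam x y μ ε)).IsOpenPosMeasure := by
    have hg : HasGaussianLaw (fun ω (p : Fin n × Fin n) =>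
        BayesCFME.response lam x y μ ε ω p.1 p.2) P :=
      ((hFZ.comp_right Sum.inr).hasGaussianLaw Finset.univ).map_fun
        (ContinuousLinearMap.pi fun p : Fin n × Fin n =>
          ContinuousLinearMap.proj (R := ℝ) (φ := fun _ : (Finset.univ : Finset (Fin n × Fin n)) => ℝ)
            ⟨p, Finset.mem_univ p⟩)
    have := BayesCFME.isOpenPosMeasure_map_of_posDef
      (Z := fun (p : Fin n × Fin n) ω => BayesCFME.response lam x y μ ε ω p.1 p.2) hg
      (hM.kronecker hRpos) fun p q => hmodel.cov_response hlam.le x y p.1 p.2 q.1 q.2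
    have hmap : P.map (BayesCFME.response lam x y μ ε) =
        (P.map fun ω (p : Fin n × Fin n) => BayesCFME.response lam x y μ ε ω p.1 p.2).map
          fun w i j => w (i, j) := by
      rw [Measure.map_map (by fun_prop) (by fun_prop)]
      rfl
    rw [hmap]
    exact Continuous.isOpenPosMeasure_map (by fun_prop) fun z => ⟨fun p => z p.1 p.2, rfl⟩
  obtain ⟨Q, hQ, hQGP⟩ := BayesCFME.exists_isPosteriorLaw_isGPLaw hFm hZm hFZ hF0 hZ0
    (BayesCFME.regressionWeight kx r lam x y x') (fun t i j => by
      simp only [hmodel.cov_response hlam.le, hmodel.cov_cfme_response]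
      exact BayesCFME.sum_regressionWeight_mul_cov hrs hMdet hR t i j) (BayesCFME.observed ky y)
  refine ⟨Q, fun Q' => ⟨fun hQ' => hQ'.unique hsupp hQ, fun h => h ▸ hQ⟩, ?_⟩
  convert hQGP using 1
  · ext t
    exact (BayesCFME.sum_regressionWeight_mul_observed hkys t).symm
  · ext s t
    -- The swap puts `cfme` first, as `cov_cfme_response` requires, but also reverses `cov[cfme s,
    -- cfme t]`; the next line restores that order.
    simp only [covariance_comm _ (BayesCFME.cfme x' μ t), hmodel.cov_cfme_response]
    rw [covariance_comm, hmodel.cov_cfme]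
    exact (BayesCFME.sub_sum_regressionWeight_eq_postCov hkxs hrs s t).symm
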